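/- **Dynamic theories.** A *dynamic theory* consists of pairwise disjoint sets $\Lambda_V$ (variables), $\Lambda_A$ (atoms), $\Lambda_P$ (programs), a nonempty universe $\mathcal U$, a nonempty set $\mathcal S$ of states, and maps $\mathcal V:\mathcal S\times\Lambda_V\to\mathcal U$, $\mathcal A:\Lambda_A\to 2^{\mathcal S}$, $\mathbf{FV}_A:\Lambda_A\to 2^{\Lambda_V}$, $\mathcal P:\Lambda_P\to 2^{\mathcal S\times\mathcal S}$, $\mathbf{FV}_P:\Lambda_P\to 2^{\Lambda_V}$ such that, writing $\mu=_V\nu$ if $\mathcal V(\mu,v)=\mathcal V(\nu,v)$ for all $v\in V$: 1. (Interpolation) for all $\mu,\nu\in\mathcal S$ and $V\subseteq\Lambda_V$ there is $\omega\in\mathcal S$ with $\omega=_V\mu$ and $\omega=_{\Lambda_V\setminus V}\nu$; 2. for every atom $a$, $\mathbf{FV}_A(a)$ is finite, and $\mu=_{\mathbf{FV}_A(a)}\nu$ implies $\mu\in\mathcal A(a)\iff\nu\in\mathcal A(a)$; 3. for every program $p$, $\mathbf{FV}_P(p)$ is finite, and for every $V\supseteq\mathbf{FV}_P(p)$, if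 $\mu=_V\nu$ and $(\mu,\omega)\in\mathcal P(p)$, then there is $\tilde\omega$ with $(\nu,\tilde\omega)\in\mathcal P(p)$ and $\omega=_V\tilde\omega$; 4. (Extensionality) for every program $p$, $\mu=_{\Lambda_V}\nu$ implies $(\mu,\omega)\in\mathcal P(p)\iff(\nu,\omega)\in\mathcal P(p)$ for all $\omega$. **Differential dynamic logic.** Let $X$ be a finite set of identifiers, and let sets of function symbols and of context symbols be given. Expressions are generated by - terms: $\theta,\eta ::= x \mid r \mid f((\theta_i)_{i\in X}) \mid \theta+\eta \mid \theta\cdot\eta \mid x' \mid (\theta)'$ with $x\in X$, $r\in\mathbb R$, $f$ a function symbol; - differential equation systems: $O ::= c \mid x'=\theta \mid (O_1,O_2)$ with $c\in X$ a system constant; - hybrid programs: $\alpha,\beta ::= a \mid x:=\theta \mid x':=\theta \mid {?\varphi} \mid O\,\&\,\varphi \mid \alpha\cup\beta \mid \alpha;\beta \mid \alpha^*$ with $a\in X$ a program constant; - formulas: $\varphi,\psi ::= \theta\ge\eta \mid P((\theta_i)_{i\in X}) \mid \neg\varphi \mid \varphi\wedge\psi \mid \exists x\,\varphi \mid \langle\alpha\rangle\varphi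 \mid C(\varphi)$ with $P\in X$ a predicate symbol and $C$ a context symbol. A state $\nu=(\nu_1,\nu_2)\in\mathbb R^X\times\mathbb R^X$ gives values $\nu_1(x)$ to the variables $x$ and $\nu_2(x)$ to the differential variables $x'$. An interpretation $I$ assigns to each $f$ a function $\mathbb R^X\to\mathbb R$, to each $P$ a subset of $\mathbb R^X$, to each $C$ a map from sets of states to sets of states, to each $a$ a relation on states, and to each $c$ a vector field on $\mathbb R^X$ and a set of bound variables. Terms are evaluated as usual, $(\theta)'$ at $\nu$ being the Fréchet derivative of $\theta$ at $\nu_1$ in the direction $\nu_2$ (unspecified if $\theta$ contains differentials or differential variables, or a function symbol that is not interpreted by an everywhere differentiable function). The vector field of $x'=\theta$ has the value of $\theta$ in the component $x$ and $0$ elsewhere (the value of $\theta$ is unspecified if $\theta$ contains differentials or differential variables), and binds $x$; the field of $(O_1,O_2)$ is the sum of the two fields and binds the variables that $O_1$ or $O_2$ binds. Connectives and modalities have their usual meaning, $\exists x$ ranges over the real values of the variable $x$, and symbols have the meaning given by $I$. The relation of $x:=\theta$ (of $x':=\theta$) changes only the value of $x$ (of $x'$), to that of $\theta$ in the initial state;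 $?\varphi$ is the identity on the states that satisfy $\varphi$; $\cup$, $;$ and ${}^*$ are union, composition and reflexive transitive closure. Finally $(\nu,\omega)$ is in the relation of $O\,\&\,\varphi$ iff there are $t\ge 0$ and a solution $y$ on $[0,t]$ of $\dot y=F(y)$, $y(0)=\nu_1$, where $F$ is the vector field of $O$, such that $\nu[y(s)]$ satisfies $\varphi$ for all $s\in[0,t]$ and $\omega=\nu[y(t)]$; here $\nu[z]$ is the state that gives $z(x)$ to $x$ and $F(z)(x)$ to $x'$ for each $x$ bound by $O$, and agrees with $\nu$ on all other variables and differential variables. **Lemma (Differential dynamic logic as a dynamic theory).** For every interpretation $I$, the following form a dynamic theory: the variables $x$ and differential variables $x'$ ($x\in X$); the atoms, i.e. the formulas $\theta\ge\eta$, $P((\theta_i)_{i\in X})$ and $C(\varphi)$; all hybrid programs; the universe $\mathbb R$; the states above with their evaluation of variables; the truth sets of atoms and the transition relations of hybrid programs; and, as $\mathbf{FV}_A$ and $\mathbf{FV}_P$, the usual syntactically computed free variables on well-formed atoms and programs and the set of all variables on ill-formed ones. Here an expression is well-formed if differentials are applied only to terms without differentials and differential variables, right-hand sides of differential equations contain neither,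 and the two parts of a system $(O_1,O_2)$ never have explicit equations for the same variable. The syntactically computed free variables are as follows. - Terms: the variables and differential variables that occur, except that $(\theta)'$ has as free variables both $x$ and $x'$ for each $x$ such that $x$ or $x'$ is free in $\theta$. - Formulas: the free variables of the immediate subexpressions, except that $\exists x\,\varphi$ removes $x$, that $\langle\alpha\rangle\varphi$ has the free variables of $\alpha$ and those of $\varphi$ not in $\mathrm{MBV}(\alpha)$, and that all variables are free in $C(\varphi)$. - Programs: all variables for a program constant $a$; the free variables of $\theta$ for $x:=\theta$ and $x':=\theta$; those of $\varphi$ for $?\varphi$; for $O\,\&\,\varphi$ those of $\varphi$ together with, for each equation $x'=\theta$ of $O$, the variables $x$, $x'$ and all undifferentiated variables free in $\theta$ (and all variables if $O$ contains a system constant); the union for $\alpha\cup\beta$; those of $\alpha$ and those of $\beta$ not in $\mathrm{MBV}(\alpha)$ for $\alpha;\beta$; those of $\alpha$ for $\alpha^*$. The must-bound variables $\mathrm{MBV}$ are $\{x\}$ for $x:=\theta$, $\{x'\}$ for $x':=\theta$, all $x,x'$ with an explicit equation for $x$ in $O$ for $O\,\&\,\varphi$, $\mathrm{MBV}(\alpha)\cap\mathrm{MBV}(\beta)$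 for $\alpha\cup\beta$, $\mathrm{MBV}(\alpha)\cup\mathrm{MBV}(\beta)$ for $\alpha;\beta$, and $\emptyset$ for all other programs. -/

import Mathlib

/-!
Dynamic theories, and differential dynamic logic (terms, systems of differential equations,
hybrid programs and formulas; dynamic and static semantics).
-/

/-! ### Dynamic theories -/

namespace DynTheory

universe u₁ u₂ u₃ u₄ u₅

set_option linter.checkUnivs false

/-- A dynamic signature: variables, first-order atoms and programs.  The three sets are separate
types, so they are pairwise disjoint by construction. -/
structure Signature where
  Var : Type u₁
  Atom : Type u₂
  Prog : Type u₃

/-- The data of a domain of computation over a signature, before any law is imposed. -/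
structure DomainData (L : Signature.{u₁, u₂, u₃}) where
  /-- the universe -/
  Univ : Type u₄
  /-- the states -/
  State : Type u₅
  /-- variable evaluation -/
  val : State → L.Var → Univ
  /-- atom evaluation -/
  atomEval : L.Atom → Set State
  /-- free variable overapproximation for atoms -/
  fvAtom : L.Atom → Set L.Var
  /-- program evaluation -/
  progEval : L.Prog → Set (State × State)
  /-- free variable overapproximation for programs -/
  fvProg : L.Prog → Set L.Var

variable {L : Signature}

/-- Two states are equal on the set `V` of variables. -/
def DomainData.EqualOn (D : DomainData L) (V : Set L.Var) (μ ν : D.State) : Prop :=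
  ∀ v ∈ V, D.val μ v = D.val ν v

/-- The signature `L` together with the data `D` is a dynamic theory. -/
structure IsDynamicTheory (L : Signature) (D : DomainData L) : Prop where
  univ_nonempty : Nonempty D.Univ
  state_nonempty : Nonempty D.State
  interpolation : ∀ (μ ν : D.State) (V : Set L.Var), ∃ ω : D.State, ∀ v : L.Var,
    (v ∈ V → D.val ω v = D.val μ v) ∧ (v ∉ V → D.val ω v = D.val ν v)
  fvAtom_overapprox : ∀ (a : L.Atom) (μ ν : D.State),
    D.EqualOn (D.fvAtom a) μ ν → (μ ∈ D.atomEval a ↔ ν ∈ D.atomEval a)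
  fvAtom_finite : ∀ a : L.Atom, (D.fvAtom a).Finite
  fvProg_overapprox : ∀ (p : L.Prog) (μ ν ω : D.State) (V : Set L.Var),
    D.fvProg p ⊆ V → D.EqualOn V μ ν → (μ, ω) ∈ D.progEval p →
      ∃ ω' : D.State, (ν, ω') ∈ D.progEval p ∧ D.EqualOn V ω ω'
  fvProg_finite : ∀ p : L.Prog, (D.fvProg p).Finite
  extensionality : ∀ (p : L.Prog) (μ ν ω : D.State),
    D.EqualOn Set.univ μ ν → ((μ, ω) ∈ D.progEval p ↔ (ν, ω) ∈ D.progEval p)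

end DynTheory

/-! ### Differential dynamic logic

Identifiers: `α` for function symbols, `β` for context symbols, and `γ` for everything else
(real variables, predicate symbols, program constants, constants for systems of differential
equations).  The type `γ` is finite wherever derivatives are involved. -/

namespace DiffDL

universe u v w

/-! #### Expressions -/

/-- Terms. A function symbol takes one argument for each element of `γ`. -/
inductive Trm (α γ : Type*) where
  | var (x : γ)
  | const (r : ℝ)
  | func (f : α) (args : γ → Trm α γ)
  | plus (s t : Trm α γ)
  | times (s t : Trm α γ)
  /-- the differential variable `x'` -/
  | diffVar (x : γ)
  /-- the differential `(t)'` of a term -/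
  | differential (t : Trm α γ)

/-- Systems of differential equations. -/
inductive ODE (α γ : Type*) where
  /-- a constant symbol standing for a system of differential equations -/
  | ovar (x : γ)
  /-- the single equation `x' = t` -/
  | osing (x : γ) (t : Trm α γ)
  /-- parallel composition of two systems -/
  | oprod (o₁ o₂ : ODE α γ)

mutual

/-- Hybrid programs. -/
inductive HP (α : Type u) (β : Type v) (γ : Type w) where
  /-- a program constant -/
  | pvar (a : γ)
  /-- `x := t` -/
  | assign (x : γ) (t : Trm α γ)
  /-- `x' := t` -/
  | diffAssign (x : γ) (t : Trm α γ)
  /-- `?φ` -/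
  | test (φ : Fml α β γ)
  /-- evolution along the system `o` within the evolution domain `φ` -/
  | evolve (o : ODE α γ) (φ : Fml α β γ)
  | choice (p q : HP α β γ)
  | seq (p q : HP α β γ)
  | loop (p : HP α β γ)

/-- Formulas. -/
inductive Fml (α : Type u) (β : Type v) (γ : Type w) where
  /-- `s ≥ t` -/
  | geq (s t : Trm α γ)
  /-- a predicate symbol applied to one argument for each element of `γ` -/
  | pred (P : γ) (args : γ → Trm α γ)
  | not (φ : Fml α β γ)
  | and (φ ψ : Fml α β γ)
  | exist (x : γ) (φ : Fml α β γ)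
  | diamond (p : HP α β γ) (φ : Fml α β γ)
  /-- a context symbol applied to a formula -/
  | inContext (C : β) (φ : Fml α β γ)

end

/-! #### Well-formed expressions

Differentials may not be nested, and no differentials or differential variables occur on the
right-hand sides of differential equations. -/

section Safe

variable {α β γ : Type*}

/-- Terms without differentials and differential variables. -/
def Trm.DFree : Trm α γ → Prop
  | .var _ => True
  | .const _ => True
  | .func _ args => ∀ i, (args i).DFree
  | .plus s t => s.DFree ∧ t.DFree
  | .times s t => s.DFree ∧ t.DFree
  | .diffVar _ => False
  | .differential _ => False

/-- Terms without nested differentials. -/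
def Trm.DSafe : Trm α γ → Prop
  | .var _ => True
  | .const _ => True
  | .func _ args => ∀ i, (args i).DSafe
  | .plus s t => s.DSafe ∧ t.DSafe
  | .times s t => s.DSafe ∧ t.DSafe
  | .diffVar _ => True
  | .differential t => t.DFree

/-- Variables with an explicit equation in the system. -/
def ODE.dom : ODE α γ → Set γ
  | .ovar _ => ∅
  | .osing x _ => {x}
  | .oprod o₁ o₂ => o₁.dom ∪ o₂.dom

def ODE.Safe : ODE α γ → Prop
  | .ovar _ => True
  | .osing _ t => t.DFree
  | .oprod o₁ o₂ => o₁.Safe ∧ o₂.Safe ∧ o₁.dom ∩ o₂.dom = ∅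

mutual

def HP.Safe : HP α β γ → Prop
  | .pvar _ => True
  | .assign _ t => t.DSafe
  | .diffAssign _ t => t.DSafe
  | .test φ => φ.Safe
  | .evolve o φ => o.Safe ∧ φ.Safe
  | .choice p q => p.Safe ∧ q.Safe
  | .seq p q => p.Safe ∧ q.Safe
  | .loop p => p.Safe

def Fml.Safe : Fml α β γ → Prop
  | .geq s t => s.DSafe ∧ t.DSafe
  | .pred _ args => ∀ i, (args i).DSafe
  | .not φ => φ.Safe
  | .and φ ψ => φ.Safe ∧ ψ.Safe
  | .exist _ φ => φ.Safe
  | .diamond p φ => p.Safe ∧ φ.Safe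
  | .inContext _ φ => φ.Safe

end

/-- Formulas that are not composed by a connective, a quantifier or a modality: comparisons,
applied predicate symbols, applied context symbols. -/
def Fml.IsAtom : Fml α β γ → Prop
  | .geq _ _ => True
  | .pred _ _ => True
  | .inContext _ _ => True
  | _ => False

end Safe

/-! #### Dynamic semantics -/

/-- A state gives a value to each variable `x` and to each differential variable `x'`. -/
abbrev State (γ : Type*) := (γ → ℝ) × (γ → ℝ)

/-- Interpretations of the symbols. -/
structure Interp (α β γ : Type*) where
  functions : α → (γ → ℝ) → ℝ
  predicates : γ → (γ → ℝ) → Prop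
  contexts : β → Set (State γ) → Set (State γ)
  programs : γ → Set (State γ × State γ)
  odes : γ → (γ → ℝ) → (γ → ℝ)
  /-- the variables bound by a constant for a system of differential equations -/
  odeBV : γ → Set γ

noncomputable section

variable {α β γ : Type*}

/-- The Fréchet derivative of (the interpretation of) a function symbol, unspecified if the
function is not differentiable everywhere. -/
def functionFrechet [Fintype γ] (I : Interp α β γ) (f : α) : (γ → ℝ) → ((γ → ℝ) →L[ℝ] ℝ) :=
  Classical.epsilon fun f' => ∀ x, HasFDerivAt (I.functions f) (f' x) x

/-- Value of a term without differentials; unspecified on other terms. -/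
def stermSem (I : Interp α β γ) : Trm α γ → (γ → ℝ) → ℝ
  | .var x, v => v x
  | .const r, _ => r
  | .func f args, v => I.functions f fun i => stermSem I (args i) v
  | .plus s t, v => stermSem I s v + stermSem I t v
  | .times s t, v => stermSem I s v * stermSem I t v
  | .diffVar _, _ => Classical.arbitrary ℝ
  | .differential _, _ => Classical.arbitrary ℝ

/-- Fréchet derivative, at `v` in direction `v'`, of a term without differentials; unspecified on
other terms. -/
def frechet [Fintype γ] (I : Interp α β γ) : Trm α γ → (γ → ℝ) → (γ → ℝ) → ℝ
  | .var x, _, v' => v' x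
  | .const _, _, _ => 0
  | .func f args, v, v' =>
      functionFrechet I f (fun i => stermSem I (args i) v) (fun i => frechet I (args i) v v')
  | .plus s t, v, v' => frechet I s v v' + frechet I t v v'
  | .times s t, v, v' => stermSem I s v * frechet I t v v' + frechet I s v v' * stermSem I t v
  | .diffVar _, _, v' => Classical.arbitrary ((γ → ℝ) → ℝ) v'
  | .differential _, _, v' => Classical.arbitrary ((γ → ℝ) → ℝ) v'

/-- Value of a term in a state. -/
def dtermSem [Fintype γ] (I : Interp α β γ) : Trm α γ → State γ → ℝ
  | .var x, ν => ν.1 x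
  | .const r, _ => r
  | .func f args, ν => I.functions f fun i => dtermSem I (args i) ν
  | .plus s t, ν => dtermSem I s ν + dtermSem I t ν
  | .times s t, ν => dtermSem I s ν * dtermSem I t ν
  | .diffVar x, ν => ν.2 x
  | .differential t, ν => frechet I t ν.1 ν.2

open Classical in
/-- The vector field of a system of differential equations. -/
def odeSem (I : Interp α β γ) : ODE α γ → (γ → ℝ) → (γ → ℝ)
  | .ovar x, v => I.odes x v
  | .osing x t, v => fun i => if i = x then stermSem I t v else 0
  | .oprod o₁ o₂, v => odeSem I o₁ v + odeSem I o₂ v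

/-- The variables bound by a system of differential equations. -/
def odeVars (I : Interp α β γ) : ODE α γ → Set γ
  | .ovar x => I.odeBV x
  | .osing x _ => {x}
  | .oprod o₁ o₂ => odeVars I o₁ ∪ odeVars I o₂

open Classical in
/-- The state reached from `ν` when the solution has the value `v`: on the bound variables of the
system, `x` has the value given by `v` and `x'` the value given by the vector field at `v`; all
other values are those of `ν`. -/
def mkV (I : Interp α β γ) (o : ODE α γ) (ν : State γ) (v : γ → ℝ) : State γ :=
  (fun i => if i ∈ odeVars I o then v i else ν.1 i,
   fun i => if i ∈ odeVars I o then odeSem I o v i else ν.2 i)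

open Classical in
/-- Replace the value of the variable `x`. -/
def repv (ν : State γ) (x : γ) (r : ℝ) : State γ := (Function.update ν.1 x r, ν.2)

open Classical in
/-- Replace the value of the differential variable `x'`. -/
def repd (ν : State γ) (x : γ) (r : ℝ) : State γ := (ν.1, Function.update ν.2 x r)

/-- `sol` solves the autonomous equation with vector field `F` on the set `T` of times, and stays
in `X` there. -/
def SolvesODE [Fintype γ] (sol : ℝ → γ → ℝ) (F : (γ → ℝ) → (γ → ℝ)) (T : Set ℝ)
    (X : Set (γ → ℝ)) : Prop :=
  (∀ s ∈ T, HasDerivWithinAt sol (F (sol s)) T s) ∧ ∀ s ∈ T, sol s ∈ X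

mutual

/-- The states in which a formula is true. -/
def fmlSem [Fintype γ] (I : Interp α β γ) : Fml α β γ → Set (State γ)
  | .geq s t => {ν | dtermSem I s ν ≥ dtermSem I t ν}
  | .pred P args => {ν | I.predicates P fun i => dtermSem I (args i) ν}
  | .not φ => (fmlSem I φ)ᶜ
  | .and φ ψ => fmlSem I φ ∩ fmlSem I ψ
  | .exist x φ => {ν | ∃ r : ℝ, repv ν x r ∈ fmlSem I φ}
  | .diamond p φ => {ν | ∃ ω, (ν, ω) ∈ progSem I p ∧ ω ∈ fmlSem I φ}
  | .inContext C φ => I.contexts C (fmlSem I φ)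

/-- The transition relation of a hybrid program. -/
def progSem [Fintype γ] (I : Interp α β γ) : HP α β γ → Set (State γ × State γ)
  | .pvar a => I.programs a
  | .assign x t => {e | e.2 = repv e.1 x (dtermSem I t e.1)}
  | .diffAssign x t => {e | e.2 = repd e.1 x (dtermSem I t e.1)}
  | .test φ => {e | e.1 = e.2 ∧ e.1 ∈ fmlSem I φ}
  | .evolve o φ => {e | ∃ (sol : ℝ → γ → ℝ) (t : ℝ), 0 ≤ t ∧
      SolvesODE sol (odeSem I o) (Set.Icc 0 t) {v | mkV I o e.1 v ∈ fmlSem I φ} ∧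
      sol 0 = e.1.1 ∧ e.2 = mkV I o e.1 (sol t)}
  | .choice p q => progSem I p ∪ progSem I q
  | .seq p q => {e | ∃ μ, (e.1, μ) ∈ progSem I p ∧ (μ, e.2) ∈ progSem I q}
  | .loop p => {e | Relation.ReflTransGen (fun μ ν => (μ, ν) ∈ progSem I p) e.1 e.2}

end

end

/-! #### Static semantics

Variables are the elements of `γ ⊕ γ`: `Sum.inl x` is the variable `x` and `Sum.inr x` is the
differential variable `x'`. -/

section Static

variable {α β γ : Type*}

/-- The variable and the differential variable that belong to a variable. -/
def primify : γ ⊕ γ → Set (γ ⊕ γ)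
  | .inl x => {.inl x, .inr x}
  | .inr x => {.inl x, .inr x}

/-- Free variables of a term. -/
def Trm.fv : Trm α γ → Set (γ ⊕ γ)
  | .var x => {.inl x}
  | .const _ => ∅
  | .func _ args => ⋃ i, (args i).fv
  | .plus s t => s.fv ∪ t.fv
  | .times s t => s.fv ∪ t.fv
  | .diffVar x => {.inr x}
  | .differential t => ⋃ x ∈ t.fv, primify x

/-- Free variables of a system of differential equations. -/
def ODE.fv : ODE α γ → Set γ
  | .ovar _ => Set.univ
  | .osing x t => {x} ∪ {y | Sum.inl y ∈ t.fv}
  | .oprod o₁ o₂ => o₁.fv ∪ o₂.fv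

/-- Bound variables of a system of differential equations. -/
def ODE.bv : ODE α γ → Set (γ ⊕ γ)
  | .ovar _ => Set.univ
  | .osing x _ => {.inl x, .inr x}
  | .oprod o₁ o₂ => o₁.bv ∪ o₂.bv

/-- Variables that are bound on every run of a hybrid program. -/
def HP.mbv : HP α β γ → Set (γ ⊕ γ)
  | .pvar _ => ∅
  | .assign x _ => {.inl x}
  | .diffAssign x _ => {.inr x}
  | .test _ => ∅
  | .evolve o _ => Sum.inl '' o.dom ∪ Sum.inr '' o.dom
  | .choice p q => p.mbv ∩ q.mbv
  | .seq p q => p.mbv ∪ q.mbv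
  | .loop _ => ∅

mutual

/-- Free variables of a formula. -/
def Fml.fv : Fml α β γ → Set (γ ⊕ γ)
  | .geq s t => s.fv ∪ t.fv
  | .pred _ args => ⋃ i, (args i).fv
  | .not φ => φ.fv
  | .and φ ψ => φ.fv ∪ ψ.fv
  | .exist x φ => φ.fv \ {.inl x}
  | .diamond p φ => p.fv ∪ (φ.fv \ p.mbv)
  | .inContext _ _ => Set.univ

/-- Free variables of a hybrid program. -/
def HP.fv : HP α β γ → Set (γ ⊕ γ)
  | .pvar _ => Set.univ
  | .assign _ t => t.fv
  | .diffAssign _ t => t.fv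
  | .test φ => φ.fv
  | .evolve o φ => o.bv ∪ Sum.inl '' o.fv ∪ φ.fv
  | .choice p q => p.fv ∪ q.fv
  | .seq p q => p.fv ∪ (q.fv \ p.mbv)
  | .loop p => p.fv

end

end Static

/-! #### Differential dynamic logic as a dynamic theory -/

/-- The signature: all variables and differential variables, all atomic formulas, all hybrid
programs. -/
def signature (α : Type u) (β : Type v) (γ : Type w) :
    DynTheory.Signature.{w, max u v w, max u v w} where
  Var := γ ⊕ γ
  Atom := {φ : Fml α β γ // φ.IsAtom}
  Prog := HP α β γ

/-- The domain of computation over the reals given by an interpretation of the symbols.  The free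
variables of well-formed expressions are the syntactic ones; an ill-formed expression, whose value
is unspecified, is assigned all variables. -/
noncomputable def domain {α : Type u} {β : Type v} {γ : Type w} [Fintype γ] (I : Interp α β γ) :
    DynTheory.DomainData (signature α β γ) where
  Univ := ℝ
  State := State γ
  val ν := Sum.elim ν.1 ν.2
  atomEval φ := fmlSem I φ.1
  fvAtom φ := {v | φ.1.Safe → v ∈ φ.1.fv}
  progEval p := progSem I p
  fvProg p := {v | p.Safe → v ∈ p.fv}

end DiffDL

namespace DiffDL

open Set

variable {α β γ : Type*}

-- Interpolation and extensionality hold because a state is nothing but the values of its variables,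
-- and finiteness because there are finitely many variables. On an ill-formed expression all
-- variables count as free, so agreeing states are equal. The content is therefore coincidence for
-- well-formed expressions, proved for formulas and programs by simultaneous induction
-- (`mem_fmlSem_of_eqOn`, `exists_mem_progSem_of_eqOn`).
--
-- The program law is too weak for this induction: `q.fv \ p.mbv` in a sequence (and likewise in a
-- diamond) requires agreement after `p` on variables on which the initial states may differ. The
-- claim is strengthened to agreement of the final states on `V ∪ p.mbv`.
--
-- The hard case is a differential equation. If `V` is everything, the states are equal. Otherwise
-- the system contains no constant, its field vanishes outside `V` and reads only components in `V`.
-- Hence a solution from `μ`, with its components outside `V` frozen at their values in `ν`, is a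
-- solution from `ν`.

/-- The values that a state gives to variables and differential variables. -/
def State.val (ν : State γ) : γ ⊕ γ → ℝ := Sum.elim ν.1 ν.2

theorem State.val_injective : Function.Injective (State.val (γ := γ)) := fun _ _ h =>
  Prod.ext (funext fun i => congrFun h (Sum.inl i)) (funext fun i => congrFun h (Sum.inr i))

theorem State.eq_of_eqOn_univ {V : Set (γ ⊕ γ)} {μ ν : State γ} (hV : univ ⊆ V)
    (h : EqOn μ.val ν.val V) : μ = ν :=
  State.val_injective (funext fun v => h (hV (mem_univ v)))

/-- Overwriting erases any disagreement at `x`. This serves the quantifier, which removes `x` from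
the free variables, and the assignment, which adds `x` to the agreement set. -/
theorem State.eqOn_repv {V : Set (γ ⊕ γ)} {μ ν : State γ} {x : γ} (r : ℝ)
    (h : EqOn μ.val ν.val (V \ {.inl x})) : EqOn (repv μ x r).val (repv ν x r).val V := by
  rintro (i | i) hi
  · by_cases hx : i = x
    · subst hx
      simp [State.val, repv]
    · simpa [State.val, repv, hx] using h (x := .inl i) ⟨hi, by simpa using hx⟩
  · simpa [State.val, repv] using h (x := .inr i) ⟨hi, by simp⟩

theorem State.eqOn_repd {V : Set (γ ⊕ γ)} {μ ν : State γ} {x : γ} (r : ℝ)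
    (h : EqOn μ.val ν.val (V \ {.inr x})) : EqOn (repd μ x r).val (repd ν x r).val V := by
  rintro (i | i) hi
  · simpa [State.val, repd] using h (x := .inl i) ⟨hi, by simp⟩
  · by_cases hx : i = x
    · subst hx
      simp [State.val, repd]
    · simpa [State.val, repd, hx] using h (x := .inr i) ⟨hi, by simpa using hx⟩

/-! ### Coincidence for terms -/

theorem stermSem_congr (I : Interp α β γ) {t : Trm α γ} (ht : t.DFree) {v w : γ → ℝ}
    (h : ∀ x, Sum.inl x ∈ t.fv → v x = w x) : stermSem I t v = stermSem I t w := by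
  induction t with
  | var x => exact h x rfl
  | const r => rfl
  | func f args ih =>
    simp only [stermSem]
    congr 1
    funext i
    exact ih i (ht i) fun x hx => h x (mem_iUnion_of_mem i hx)
  | plus s t ihs iht =>
    simp only [stermSem]
    rw [ihs ht.1 fun x hx => h x (.inl hx), iht ht.2 fun x hx => h x (.inr hx)]
  | times s t ihs iht =>
    simp only [stermSem]
    rw [ihs ht.1 fun x hx => h x (.inl hx), iht ht.2 fun x hx => h x (.inr hx)]
  | diffVar x => exact ht.elim
  | differential t => exact ht.elim

/-- No differentiability is needed: `functionFrechet I f` is one fixed choice, so equal points and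
directions give equal values. -/
theorem frechet_congr [Fintype γ] (I : Interp α β γ) {t : Trm α γ} (ht : t.DFree)
    {v w v' w' : γ → ℝ} (h : ∀ x, Sum.inl x ∈ t.fv → v x = w x)
    (h' : ∀ x, Sum.inl x ∈ t.fv → v' x = w' x) : frechet I t v v' = frechet I t w w' := by
  induction t with
  | var x => exact h' x rfl
  | const r => rfl
  | func f args ih =>
    have hs : (fun i => stermSem I (args i) v) = fun i => stermSem I (args i) w :=
      funext fun i => stermSem_congr I (ht i) fun x hx => h x (mem_iUnion_of_mem i hx)
    have hf : (fun i => frechet I (args i) v v') = fun i => frechet I (args i) w w' :=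
      funext fun i => ih i (ht i) (fun x hx => h x (mem_iUnion_of_mem i hx))
        fun x hx => h' x (mem_iUnion_of_mem i hx)
    simp only [frechet, hs, hf]
  | plus s t ihs iht =>
    simp only [frechet]
    rw [ihs ht.1 (fun x hx => h x (.inl hx)) fun x hx => h' x (.inl hx),
      iht ht.2 (fun x hx => h x (.inr hx)) fun x hx => h' x (.inr hx)]
  | times s t ihs iht =>
    simp only [frechet]
    rw [ihs ht.1 (fun x hx => h x (.inl hx)) fun x hx => h' x (.inl hx),
      iht ht.2 (fun x hx => h x (.inr hx)) fun x hx => h' x (.inr hx),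
      stermSem_congr I ht.1 fun x hx => h x (.inl hx),
      stermSem_congr I ht.2 fun x hx => h x (.inr hx)]
  | diffVar x => exact ht.elim
  | differential t => exact ht.elim

theorem dtermSem_congr [Fintype γ] (I : Interp α β γ) {t : Trm α γ} (ht : t.DSafe)
    {μ ν : State γ} (h : EqOn μ.val ν.val t.fv) : dtermSem I t μ = dtermSem I t ν := by
  induction t with
  | var x => exact h (x := .inl x) rfl
  | const r => rfl
  | func f args ih =>
    simp only [dtermSem]
    congr 1
    funext i
    exact ih i (ht i) (h.mono (subset_iUnion_of_subset i subset_rfl))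
  | plus s t ihs iht =>
    simp only [dtermSem]
    rw [ihs ht.1 (h.mono subset_union_left), iht ht.2 (h.mono subset_union_right)]
  | times s t ihs iht =>
    simp only [dtermSem]
    rw [ihs ht.1 (h.mono subset_union_left), iht ht.2 (h.mono subset_union_right)]
  | diffVar x => exact h (x := .inr x) rfl
  | differential t =>
    -- The derivative reads both the point and the direction; `primify` puts `x` and `x'` among the
    -- free variables for this reason.
    exact frechet_congr I ht
      (fun x hx => h (x := .inl x) (mem_biUnion hx (.inl rfl)))
      fun x hx => h (x := .inr x) (mem_biUnion hx (.inr rfl))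

/-! ### Systems of differential equations -/

/-- Bound variables of a system also count as free in the program, so its must-bound variables add
nothing to `V`. -/
theorem ODE.image_dom_subset_bv (o : ODE α γ) :
    Sum.inl '' o.dom ∪ Sum.inr '' o.dom ⊆ o.bv := by
  induction o with
  | ovar x => exact subset_univ _
  | osing x t =>
    rintro _ (⟨y, rfl, rfl⟩ | ⟨y, rfl, rfl⟩)
    exacts [.inl rfl, .inr rfl]
  | oprod o₁ o₂ h₁ h₂ =>
    rintro _ (⟨y, hy | hy, rfl⟩ | ⟨y, hy | hy, rfl⟩)
    exacts [.inl (h₁ (.inl ⟨y, hy, rfl⟩)), .inr (h₂ (.inl ⟨y, hy, rfl⟩)),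
      .inl (h₁ (.inr ⟨y, hy, rfl⟩)), .inr (h₂ (.inr ⟨y, hy, rfl⟩))]

/-- A system whose syntactically bound variables are not all variables contains no constants, so
its vector field vanishes outside of these variables. -/
theorem odeSem_eq_zero (I : Interp α β γ) {o : ODE α γ} {V : Set (γ ⊕ γ)}
    (hV : V ≠ univ) (ho : o.bv ⊆ V) {i : γ} (hi : Sum.inl i ∉ V) (v : γ → ℝ) :
    odeSem I o v i = 0 := by
  induction o with
  -- A constant binds all variables syntactically, which forces `V = univ`.
  | ovar x => exact (hV (univ_subset_iff.1 ho)).elim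
  | osing x t =>
    have hx : i ≠ x := fun h => hi (ho (.inl (congrArg Sum.inl h)))
    simp [odeSem, hx]
  | oprod o₁ o₂ h₁ h₂ =>
    simp [odeSem, h₁ (subset_union_left.trans ho), h₂ (subset_union_right.trans ho)]

theorem odeSem_congr (I : Interp α β γ) {o : ODE α γ} (hs : o.Safe) {v w : γ → ℝ}
    (h : EqOn v w o.fv) : odeSem I o v = odeSem I o w := by
  induction o with
  | ovar x => rw [show v = w from funext fun i => h (mem_univ i)]
  | osing x t =>
    simp only [odeSem]
    rw [stermSem_congr I hs fun y hy => h (.inr hy)]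
  | oprod o₁ o₂ h₁ h₂ =>
    simp only [odeSem]
    rw [h₁ hs.1 (h.mono subset_union_left), h₂ hs.2.1 (h.mono subset_union_right)]

/-- Both states are overwritten at the same positions, those in `odeVars I o`, and the fields at `v`
and `w` coincide because all their free variables lie in `V`. -/
theorem eqOn_mkV (I : Interp α β γ) {o : ODE α γ} (hs : o.Safe) {V : Set (γ ⊕ γ)}
    (hfv : Sum.inl '' o.fv ⊆ V) {μ ν : State γ} (h : EqOn μ.val ν.val V) {v w : γ → ℝ}
    (hvw : ∀ i, Sum.inl i ∈ V → v i = w i) :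
    EqOn (mkV I o μ v).val (mkV I o ν w).val V := by
  have hF : odeSem I o v = odeSem I o w :=
    odeSem_congr I hs fun i hi => hvw i (hfv (mem_image_of_mem _ hi))
  rintro (i | i) hi
  · have hμν : μ.1 i = ν.1 i := h hi
    simp only [State.val, mkV, Sum.elim_inl, hvw i hi, hμν]
  · have hμν : μ.2 i = ν.2 i := h hi
    simp only [State.val, mkV, Sum.elim_inr, hF, hμν]

open Classical in
/-- A solution may be replaced by a constant in the components outside of a set that contains the
bound and the free variables of the system. -/
theorem hasDerivWithinAt_piecewise [Fintype γ] (I : Interp α β γ) {o : ODE α γ} (hs : o.Safe)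
    {V : Set (γ ⊕ γ)} (hV : V ≠ univ) (hbv : o.bv ⊆ V) (hfv : Sum.inl '' o.fv ⊆ V)
    {sol : ℝ → γ → ℝ} {T : Set ℝ} {s : ℝ} (c : γ → ℝ)
    (h : HasDerivWithinAt sol (odeSem I o (sol s)) T s) :
    HasDerivWithinAt (fun s i => if Sum.inl i ∈ V then sol s i else c i)
      (odeSem I o fun i => if Sum.inl i ∈ V then sol s i else c i) T s := by
  have hF : (odeSem I o fun i => if Sum.inl i ∈ V then sol s i else c i) = odeSem I o (sol s) :=
    odeSem_congr I hs fun i hi => if_pos (hfv (mem_image_of_mem _ hi))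
  rw [hF]
  refine hasDerivWithinAt_pi.2 fun i => ?_
  by_cases hi : Sum.inl i ∈ V
  · simpa only [if_pos hi] using hasDerivWithinAt_pi.1 h i
  -- A frozen component has derivative zero, as does the field there.
  · simpa only [if_neg hi, odeSem_eq_zero I hV hbv hi] using hasDerivWithinAt_const s T (c i)

/-! ### Coincidence for formulas and programs -/

mutual

theorem mem_fmlSem_of_eqOn [Fintype γ] (I : Interp α β γ) : ∀ (φ : Fml α β γ), φ.Safe →
    ∀ {μ ν : State γ}, EqOn μ.val ν.val φ.fv → μ ∈ fmlSem I φ → ν ∈ fmlSem I φ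
  | .geq s t, hs, μ, ν, h, hμ => by
    simp only [fmlSem, mem_ofPred_eq] at hμ ⊢
    simp only [Fml.Safe] at hs
    simp only [Fml.fv] at h
    rwa [← dtermSem_congr I hs.1 (h.mono subset_union_left),
      ← dtermSem_congr I hs.2 (h.mono subset_union_right)]
  | .pred P args, hs, μ, ν, h, hμ => by
    simp only [fmlSem, mem_ofPred_eq] at hμ ⊢
    simp only [Fml.Safe] at hs
    simp only [Fml.fv] at h
    have hargs : (fun i => dtermSem I (args i) μ) = fun i => dtermSem I (args i) ν :=
      funext fun i => dtermSem_congr I (hs i) (h.mono (subset_iUnion_of_subset i subset_rfl))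
    rwa [← hargs]
  | .not φ, hs, μ, ν, h, hμ => by
    simp only [fmlSem, mem_compl_iff] at hμ ⊢
    simp only [Fml.Safe] at hs
    simp only [Fml.fv] at h
    -- One implication suffices for the induction, since the two states are arbitrary and agreement
    -- is symmetric.
    exact fun hν => hμ (mem_fmlSem_of_eqOn I φ hs h.symm hν)
  | .and φ ψ, hs, μ, ν, h, hμ => by
    simp only [fmlSem] at hμ ⊢
    simp only [Fml.Safe] at hs
    simp only [Fml.fv] at h
    exact ⟨mem_fmlSem_of_eqOn I φ hs.1 (h.mono subset_union_left) hμ.1,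
      mem_fmlSem_of_eqOn I ψ hs.2 (h.mono subset_union_right) hμ.2⟩
  | .exist x φ, hs, μ, ν, h, hμ => by
    simp only [fmlSem, mem_ofPred_eq] at hμ ⊢
    simp only [Fml.Safe] at hs
    simp only [Fml.fv] at h
    obtain ⟨r, hr⟩ := hμ
    exact ⟨r, mem_fmlSem_of_eqOn I φ hs (State.eqOn_repv r h) hr⟩
  | .diamond p φ, hs, μ, ν, h, hμ => by
    simp only [fmlSem, mem_ofPred_eq] at hμ ⊢
    simp only [Fml.Safe] at hs
    simp only [Fml.fv] at h
    obtain ⟨ω, hω, hφ⟩ := hμ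
    obtain ⟨ω', hω', hωω'⟩ := exists_mem_progSem_of_eqOn I p hs.1 subset_union_left h hω
    refine ⟨ω', hω', mem_fmlSem_of_eqOn I φ hs.2 (hωω'.mono ?_) hφ⟩
    -- The must-bound variables restore exactly what the diamond removed from `φ.fv`.
    rw [union_assoc, sdiff_union_self]
    exact subset_union_of_subset_right subset_union_left _
  | .inContext C φ, hs, μ, ν, h, hμ => by
    simp only [Fml.fv] at h
    rwa [← State.eq_of_eqOn_univ subset_rfl h]

/-- A run is matched by a run from any state that agrees on a set containing the free variables;
the final states also agree on the must-bound variables. -/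
theorem exists_mem_progSem_of_eqOn [Fintype γ] (I : Interp α β γ) : ∀ (p : HP α β γ), p.Safe →
    ∀ {V : Set (γ ⊕ γ)} {μ ν ω : State γ}, p.fv ⊆ V → EqOn μ.val ν.val V →
      (μ, ω) ∈ progSem I p → ∃ ω', (ν, ω') ∈ progSem I p ∧ EqOn ω.val ω'.val (V ∪ p.mbv)
  | .pvar a, _, V, μ, ν, ω, hV, h, hω => by
    simp only [HP.fv] at hV
    exact ⟨ω, State.eq_of_eqOn_univ hV h ▸ hω, fun _ _ => rfl⟩
  | .assign x t, hs, V, μ, ν, ω, hV, h, hω => by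
    simp only [HP.Safe] at hs
    simp only [HP.fv] at hV
    simp only [progSem, mem_ofPred_eq] at hω ⊢
    refine ⟨_, rfl, ?_⟩
    rw [hω, ← dtermSem_congr I hs (h.mono hV), HP.mbv]
    refine State.eqOn_repv _ (h.mono ?_)
    rw [union_sdiff_right]
    exact sdiff_subset
  | .diffAssign x t, hs, V, μ, ν, ω, hV, h, hω => by
    simp only [HP.Safe] at hs
    simp only [HP.fv] at hV
    simp only [progSem, mem_ofPred_eq] at hω ⊢
    refine ⟨_, rfl, ?_⟩
    rw [hω, ← dtermSem_congr I hs (h.mono hV), HP.mbv]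
    refine State.eqOn_repd _ (h.mono ?_)
    rw [union_sdiff_right]
    exact sdiff_subset
  | .test φ, hs, V, μ, ν, ω, hV, h, hω => by
    simp only [HP.Safe] at hs
    simp only [HP.fv] at hV
    simp only [progSem, mem_ofPred_eq] at hω ⊢
    refine ⟨ν, ⟨rfl, mem_fmlSem_of_eqOn I φ hs (h.mono hV) hω.2⟩, ?_⟩
    rwa [← hω.1, HP.mbv, union_empty]
  | .evolve o φ, hs, V, μ, ν, ω, hV, h, hω => by
    classical
    simp only [HP.Safe] at hs
    simp only [HP.fv, union_subset_iff] at hV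
    obtain ⟨⟨hbv, hfv⟩, hφ⟩ := hV
    rw [HP.mbv, union_eq_self_of_subset_right (o.image_dom_subset_bv.trans hbv)]
    -- The case `V = univ` covers all systems with constants, whose fields are arbitrary.
    by_cases hVu : V = univ
    · exact ⟨ω, State.eq_of_eqOn_univ hVu.ge h ▸ hω, fun _ _ => rfl⟩
    simp only [progSem, mem_ofPred_eq] at hω ⊢
    obtain ⟨sol, t, ht, ⟨hsol, hdom⟩, h0, rfl⟩ := hω
    have hmk : ∀ s, EqOn (mkV I o μ (sol s)).val
        (mkV I o ν fun i => if Sum.inl i ∈ V then sol s i else ν.1 i).val V := fun s =>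
      eqOn_mkV I hs.1 hfv h fun i hi => (if_pos hi).symm
    refine ⟨_, ⟨fun s i => if Sum.inl i ∈ V then sol s i else ν.1 i, t, ht, ⟨?_, ?_⟩, ?_, rfl⟩,
      hmk t⟩
    · exact fun s hst => hasDerivWithinAt_piecewise I hs.1 hVu hbv hfv ν.1 (hsol s hst)
    · exact fun s hst => mem_fmlSem_of_eqOn I φ hs.2 ((hmk s).mono hφ) (hdom s hst)
    -- Initial value: on `V` the old solution starts at `μ`, which agrees with `ν`; elsewhere the
    -- component is frozen at `ν`.
    · funext i
      beta_reduce
      split_ifs with hi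
      · rw [h0]
        exact h hi
      · rfl
  | .choice p q, hs, V, μ, ν, ω, hV, h, hω => by
    simp only [HP.Safe] at hs
    simp only [HP.fv, union_subset_iff] at hV
    simp only [progSem] at hω ⊢
    rw [HP.mbv]
    obtain hω | hω := hω
    · obtain ⟨ω', hω', he⟩ := exists_mem_progSem_of_eqOn I p hs.1 hV.1 h hω
      exact ⟨ω', .inl hω', he.mono (union_subset_union_right _ inter_subset_left)⟩
    · obtain ⟨ω', hω', he⟩ := exists_mem_progSem_of_eqOn I q hs.2 hV.2 h hω
      exact ⟨ω', .inr hω', he.mono (union_subset_union_right _ inter_subset_right)⟩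
  | .seq p q, hs, V, μ, ν, ω, hV, h, hω => by
    simp only [HP.Safe] at hs
    simp only [HP.fv, union_subset_iff, sdiff_subset_iff] at hV
    simp only [progSem, mem_ofPred_eq] at hω ⊢
    obtain ⟨κ, hκ, hω⟩ := hω
    obtain ⟨κ', hκ', hp⟩ := exists_mem_progSem_of_eqOn I p hs.1 hV.1 h hκ
    -- The induction hypothesis for `q` is used with `V ∪ p.mbv` in place of `V`.
    obtain ⟨ω', hω', hq⟩ := exists_mem_progSem_of_eqOn I q hs.2
      (hV.2.trans (union_comm _ _).subset) hp hω
    refine ⟨ω', ⟨κ', hκ', hω'⟩, ?_⟩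
    rwa [HP.mbv, ← union_assoc]
  | .loop p, hs, V, μ, ν, ω, hV, h, hω => by
    simp only [HP.Safe] at hs
    simp only [HP.fv] at hV
    simp only [progSem, mem_ofPred_eq] at hω ⊢
    rw [HP.mbv, union_empty]
    -- Agreement on the fixed set `V` is the invariant carried along the iterations.
    induction hω with
    | refl => exact ⟨ν, .refl, h⟩
    | tail _ hstep ih =>
      obtain ⟨κ', hκ', he⟩ := ih
      obtain ⟨ω', hω', he'⟩ := exists_mem_progSem_of_eqOn I p hs hV he hstep
      exact ⟨ω', hκ'.tail hω', he'.mono subset_union_left⟩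

end

end DiffDL

-- The laws of a dynamic theory

open DiffDL in
theorem mainTheorem12 {α β γ : Type*} [Fintype γ] (I : DiffDL.Interp α β γ) :
    DynTheory.IsDynamicTheory (DiffDL.signature α β γ) (DiffDL.domain I) where
  univ_nonempty := ⟨(0 : ℝ)⟩
  state_nonempty := ⟨((0, 0) : State γ)⟩
  interpolation μ ν V := by
    classical
    refine ⟨((fun i => if Sum.inl i ∈ V then μ.1 i else ν.1 i,
      fun i => if Sum.inr i ∈ V then μ.2 i else ν.2 i) : State γ), ?_⟩
    rintro (i | i)
    · exact ⟨fun h => if_pos h, fun h => if_neg h⟩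
    · exact ⟨fun h => if_pos h, fun h => if_neg h⟩
  fvAtom_overapprox a μ ν h := by
    by_cases hs : a.1.Safe
    · have h' : Set.EqOn (State.val μ) (State.val ν) a.1.fv := fun v hv => h v fun _ => hv
      exact ⟨mem_fmlSem_of_eqOn I a.1 hs h', mem_fmlSem_of_eqOn I a.1 hs h'.symm⟩
    -- Ill-formed: the condition defining `fvAtom` is vacuous, so every variable belongs to it.
    · have : μ = ν := State.val_injective (funext fun v => h v fun hs' => (hs hs').elim)
      rw [this]
  fvAtom_finite a := Set.toFinite (α := γ ⊕ γ) _
  fvProg_overapprox p μ ν ω V hV h hω := by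
    by_cases hs : p.Safe
    · obtain ⟨ω', hω', he⟩ :=
        exists_mem_progSem_of_eqOn I p hs (fun v hv => hV fun _ => hv) (fun v hv => h v hv) hω
      exact ⟨ω', hω', fun v hv => he (.inl hv)⟩
    · have : μ = ν :=
        State.val_injective (funext fun v => h v (hV fun hs' => (hs hs').elim))
      exact ⟨ω, this ▸ hω, fun _ _ => rfl⟩
  fvProg_finite p := Set.toFinite (α := γ ⊕ γ) _
  extensionality p μ ν ω h := by
    have : μ = ν := State.val_injective (funext fun v => h v (Set.mem_univ v))
    rw [this]
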